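/- Let $\mathcal{M}\subset\mathbb{R}^{n\times m}$ be a smooth manifold without boundary, smoothly embedded in Euclidean space, with the Riemannian metric induced by the Euclidean inner product. Let $d_g(X,Y)$ be the geodesic distance, i.e. the infimum of the lengths of curves in $\mathcal{M}$ from $X$ to $Y$ ($+\infty$ if there are none), and let $\|X-Y\|$ be the chordal (Euclidean) distance. (i) For every $X\in\mathcal{M}$ and every $\varepsilon>0$ there is a $\delta>0$ such that the closed chordal ball $\mathcal{A}_\delta(X)=\{Y\in\mathcal{M}:\|X-Y\|\le\delta\}$ is contained in the closed geodesic ball $\{Y\in\mathcal{M}: d_g(X,Y)\le\varepsilon\}$. (ii) For $X\in\mathcal{M}$ let $r(X)\in[0,\infty]$ be the injectivity radius at $X$, i.e. the supremum of the $\varepsilon\ge 0$ such that the exponential map $\exp_X$ is defined on the open ball of radius $\varepsilon$ around $0$ in $T_X\mathcal{M}$ and is a smooth diffeomorphism from it onto the open geodesic ball $\{Y\in\mathcal{M}:d_g(X,Y)<\varepsilon\}$. Let $a(X)\in[0,\infty]$ be the supremum of the $\delta\ge0$ such that $\mathcal{A}_\delta(X)$ is contained in the geodesic ball of radius $r(X)$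 around $X$. If $\mathcal{M}$ is closed (compact without boundary) and $R=\inf_{X\in\mathcal{M}}r(X)>0$, then $A=\inf_{X\in\mathcal{M}}a(X)>0$; this holds both when the geodesic ball in the definition of $a(X)$ is taken open and when it is taken closed. -/

import Mathlib

open Set Bundle Manifold Topology
open scoped ENNReal NNReal ContDiff

noncomputable section

namespace EmbeddedManifold

/-- The open geodesic ball of radius `ε` around `x`. The geodesic distance is the infimum of the
lengths of curves from `x` to `y`; it is `∞` when no such curve exists. -/
def geodesicBall (d : ℕ) {M : Type*} [TopologicalSpace M]
    [ChartedSpace (EuclideanSpace ℝ (Fin d)) M]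
    [RiemannianBundle (fun x : M => TangentSpace (𝓡 d) x)] (x : M) (ε : ℝ≥0∞) : Set M :=
  {y | riemannianEDist (𝓡 d) x y < ε}

/-- The closed geodesic ball of radius `ε` around `x`. -/
def geodesicClosedBall (d : ℕ) {M : Type*} [TopologicalSpace M]
    [ChartedSpace (EuclideanSpace ℝ (Fin d)) M]
    [RiemannianBundle (fun x : M => TangentSpace (𝓡 d) x)] (x : M) (ε : ℝ≥0∞) : Set M :=
  {y | riemannianEDist (𝓡 d) x y ≤ ε}

section Chordal

variable {M E : Type*} [NormedAddCommGroup E]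

/-- The closed chordal ball of radius `δ` around `x`, as a subset of `M`. -/
def chordalBall (ι : M → E) (x : M) (δ : ℝ) : Set M :=
  {y | ‖ι x - ι y‖ ≤ δ}

/-- The radius of the largest closed chordal ball around `x` that is contained in `B`
(the supremum of the admissible radii, possibly `∞`). -/
def chordalRadius (ι : M → E) (x : M) (B : Set M) : ℝ≥0∞ :=
  ⨆ (δ : ℝ≥0) (_ : chordalBall ι x δ ⊆ B), (δ : ℝ≥0∞)

end Chordal

/-- The differential of `ι : M → E` at `x`, as a linear map into the vector space `E`. -/
def dMap (d : ℕ) {M : Type*} [TopologicalSpace M] [ChartedSpace (EuclideanSpace ℝ (Fin d)) M]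
    {E : Type*} [NormedAddCommGroup E] [InnerProductSpace ℝ E] (ι : M → E) (x : M) :
    TangentSpace (𝓡 d) x →L[ℝ] E :=
  mfderiv (𝓡 d) 𝓘(ℝ, E) ι x

/-- The Riemannian metric of `M` is the one induced by `ι` from the inner product of `E`. -/
def IsInducedMetric (d : ℕ) {M : Type*} [TopologicalSpace M]
    [ChartedSpace (EuclideanSpace ℝ (Fin d)) M]
    [RiemannianBundle (fun x : M => TangentSpace (𝓡 d) x)]
    {E : Type*} [NormedAddCommGroup E] [InnerProductSpace ℝ E] (ι : M → E) : Prop :=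
  ∀ (x : M) (v w : TangentSpace (𝓡 d) x),
    inner ℝ v w = inner ℝ (dMap d ι x v) (dMap d ι x w)

/-- `γ` is a (constant speed) geodesic on the open set `s` of times, for the metric induced by
`ι`: the covariant acceleration, that is the orthogonal projection of the acceleration in `E`
onto the tangent space, vanishes. -/
def IsGeodesicOn (d : ℕ) {M : Type*} [TopologicalSpace M]
    [ChartedSpace (EuclideanSpace ℝ (Fin d)) M]
    {E : Type*} [NormedAddCommGroup E] [InnerProductSpace ℝ E]
    (ι : M → E) (γ : ℝ → M) (s : Set ℝ) : Prop :=
  IsOpen s ∧ ContMDiffOn 𝓘(ℝ, ℝ) (𝓡 d) ∞ γ s ∧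
    ∀ t ∈ s, ∀ v : TangentSpace (𝓡 d) (γ t),
      inner ℝ (deriv (deriv (ι ∘ γ)) t) (dMap d ι (γ t) v) = 0

/-- `y` is the endpoint at time `1` of a geodesic that starts at `x` at time `0` with initial
velocity `v`. -/
def IsExp (d : ℕ) {M : Type*} [TopologicalSpace M] [ChartedSpace (EuclideanSpace ℝ (Fin d)) M]
    {E : Type*} [NormedAddCommGroup E] [InnerProductSpace ℝ E]
    (ι : M → E) (x : M) (v : TangentSpace (𝓡 d) x) (y : M) : Prop :=
  ∃ (γ : ℝ → M) (s : Set ℝ), Icc (0 : ℝ) 1 ⊆ s ∧ IsGeodesicOn d ι γ s ∧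
    γ 0 = x ∧ deriv (ι ∘ γ) 0 = dMap d ι x v ∧ γ 1 = y

/-- The set of tangent vectors at `x` at which the exponential map is defined. -/
def expDomain (d : ℕ) {M : Type*} [TopologicalSpace M]
    [ChartedSpace (EuclideanSpace ℝ (Fin d)) M]
    {E : Type*} [NormedAddCommGroup E] [InnerProductSpace ℝ E]
    (ι : M → E) (x : M) : Set (TangentSpace (𝓡 d) x) :=
  {v | ∃ y, IsExp d ι x v y}

open Classical in
/-- The exponential map at `x` (with the value `x` outside `expDomain d ι x`). -/
def expMap (d : ℕ) {M : Type*} [TopologicalSpace M] [ChartedSpace (EuclideanSpace ℝ (Fin d)) M]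
    {E : Type*} [NormedAddCommGroup E] [InnerProductSpace ℝ E]
    (ι : M → E) (x : M) (v : TangentSpace (𝓡 d) x) : M :=
  if h : ∃ y, IsExp d ι x v y then h.choose else x

/-- The injectivity radius at `x`: the supremum of the radii `ε` such that the exponential map is
defined on the open ball of radius `ε` in the tangent space at `x` and restricts to a smooth
diffeomorphism from it onto the open geodesic ball of radius `ε` around `x`. -/
def injectivityRadius (d : ℕ) {M : Type*} [TopologicalSpace M]
    [ChartedSpace (EuclideanSpace ℝ (Fin d)) M]
    [RiemannianBundle (fun x : M => TangentSpace (𝓡 d) x)]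
    {E : Type*} [NormedAddCommGroup E] [InnerProductSpace ℝ E] (ι : M → E) (x : M) : ℝ≥0∞ :=
  ⨆ (ε : ℝ≥0) (_ : Metric.ball (0 : TangentSpace (𝓡 d) x) ε ⊆ expDomain d ι x ∧
    ∃ Φ : PartialDiffeomorph 𝓘(ℝ, TangentSpace (𝓡 d) x) (𝓡 d) (TangentSpace (𝓡 d) x) M ∞,
      Φ.source = Metric.ball (0 : TangentSpace (𝓡 d) x) ε ∧
      Φ.target = geodesicBall d x ε ∧
      EqOn Φ.toFun (expMap d ι x) Φ.source), (ε : ℝ≥0∞)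

end EmbeddedManifold

end

/-!
The topology of an embedded manifold is the one induced by the chordal distance, and points of a
Riemannian manifold that are close for the topology are close for the geodesic distance
(`eventually_riemannianEDist_lt`: in a chart the metric is locally bounded by a multiple of the
Euclidean one, so straight segments in the chart are short curves). Together this gives a chordal
ball inside every geodesic ball (`exists_chordalBall_subset_geodesicBall`).

On a compact manifold the radius can be chosen uniformly. Each point `p` has a chordal
neighbourhood whose points have geodesic distance less than `ε / 2` to `p`; if `δ` is a Lebesgue
number of this cover of the compact set `ι(M)`, then any two points at chordal distance less than
`δ` share such a neighbourhood, hence have geodesic distance less than `ε`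
(`exists_forall_chordalBall_subset_geodesicBall`). With `ε` the infimum of the injectivity radii,
this is a uniform positive lower bound for the chordal radii of the geodesic balls.
-/

namespace EmbeddedManifold

theorem le_chordalRadius {M E : Type*} [NormedAddCommGroup E] {ι : M → E} {x : M} {B : Set M}
    {δ : ℝ≥0} (h : chordalBall ι x δ ⊆ B) : (δ : ℝ≥0∞) ≤ chordalRadius ι x B :=
  le_iSup₂_of_le δ h le_rfl

theorem chordalRadius_mono {M E : Type*} [NormedAddCommGroup E] (ι : M → E) (x : M) {B C : Set M}
    (h : B ⊆ C) : chordalRadius ι x B ≤ chordalRadius ι x C :=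
  iSup₂_le fun _ hδ => le_chordalRadius (hδ.trans h)

section

variable {d : ℕ} {M : Type*} [TopologicalSpace M] [ChartedSpace (EuclideanSpace ℝ (Fin d)) M]
  [RiemannianBundle (fun x : M => TangentSpace (𝓡 d) x)]

theorem geodesicBall_mono (x : M) {ε ε' : ℝ≥0∞} (h : ε ≤ ε') :
    geodesicBall d x ε ⊆ geodesicBall d x ε' :=
  fun _ hy => lt_of_lt_of_le hy h

theorem geodesicBall_subset_geodesicClosedBall (x : M) (ε : ℝ≥0∞) :
    geodesicBall d x ε ⊆ geodesicClosedBall d x ε :=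
  fun _ hy => LT.lt.le (α := ℝ≥0∞) hy

variable [IsManifold (𝓡 d) 1 M]
  [IsContinuousRiemannianBundle (EuclideanSpace ℝ (Fin d))
    (fun x : M => TangentSpace (𝓡 d) x)]
  {E : Type*} [NormedAddCommGroup E] {ι : M → E}

theorem exists_chordalBall_subset_geodesicBall (hι : IsInducing ι) (x : M) {ε : ℝ≥0∞}
    (hε : 0 < ε) : ∃ δ : ℝ, 0 < δ ∧ chordalBall ι x δ ⊆ geodesicBall d x ε := by
  have h := eventually_riemannianEDist_lt (𝓡 d) x hε
  rw [hι.nhds_eq_comap, (Metric.nhds_basis_closedBall.comap ι).eventually_iff] at h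
  obtain ⟨δ, hδ, h⟩ := h
  refine ⟨δ, hδ, fun y hy => h ?_⟩
  rwa [mem_preimage, Metric.mem_closedBall', dist_eq_norm]

/-- On a compact manifold, the radius of a chordal ball inside a geodesic ball of given radius can
be chosen independently of the centre. -/
theorem exists_forall_chordalBall_subset_geodesicBall [CompactSpace M] (hι : IsInducing ι)
    {ε : ℝ≥0∞} (hε : 0 < ε) :
    ∃ δ : ℝ, 0 < δ ∧ ∀ x : M, chordalBall ι x δ ⊆ geodesicBall d x ε := by
  have hloc (p : M) : ∃ U : Set E, IsOpen U ∧ ι p ∈ U ∧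
      ∀ y, ι y ∈ U → riemannianEDist (𝓡 d) p y < ε / 2 := by
    have h := eventually_riemannianEDist_lt (𝓡 d) p (ENNReal.half_pos hε.ne')
    rw [hι.nhds_eq_comap, ((nhds_basis_opens (ι p)).comap ι).eventually_iff] at h
    obtain ⟨U, ⟨hp, hU⟩, h⟩ := h
    exact ⟨U, hU, hp, fun y hy => h hy⟩
  choose U hU hpU hUε using hloc
  obtain ⟨δ, hδ, hL⟩ := lebesgue_number_lemma_of_metric (isCompact_range hι.continuous) hU
    (range_subset_iff.2 fun p => mem_iUnion.2 ⟨p, hpU p⟩)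
  -- Lebesgue's lemma speaks of open balls, so the closed ball needs a smaller radius.
  refine ⟨δ / 2, half_pos hδ, fun x y hy => ?_⟩
  obtain ⟨p, hp⟩ := hL (ι x) (mem_range_self x)
  have hx : riemannianEDist (𝓡 d) x p < ε / 2 := by
    rw [riemannianEDist_comm]
    exact hUε p x (hp (Metric.mem_ball_self hδ))
  have hy' : riemannianEDist (𝓡 d) p y < ε / 2 := by
    refine hUε p y (hp ?_)
    rw [Metric.mem_ball', dist_eq_norm]
    exact lt_of_le_of_lt hy (half_lt_self hδ)
  calc riemannianEDist (𝓡 d) x y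
      ≤ riemannianEDist (𝓡 d) x p + riemannianEDist (𝓡 d) p y := riemannianEDist_triangle
    _ < ε / 2 + ε / 2 := ENNReal.add_lt_add hx hy'
    _ = ε := ENNReal.add_halves ε

end

end EmbeddedManifold

theorem mainTheorem7 (n m d : ℕ) {M : Type*} [TopologicalSpace M]
    [ChartedSpace (EuclideanSpace ℝ (Fin d)) M] [IsManifold (𝓡 d) ∞ M]
    [RiemannianBundle (fun x : M => TangentSpace (𝓡 d) x)]
    [IsContMDiffRiemannianBundle (𝓡 d) ∞ (EuclideanSpace ℝ (Fin d))
      (fun x : M => TangentSpace (𝓡 d) x)]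
    (ι : M → EuclideanSpace ℝ (Fin n × Fin m))
    (hι : IsSmoothEmbedding (𝓡 d) 𝓘(ℝ, EuclideanSpace ℝ (Fin n × Fin m)) ∞ ι)
    (hg : EmbeddedManifold.IsInducedMetric d ι) :
    (∀ (x : M) (ε : ℝ), 0 < ε → ∃ δ : ℝ, 0 < δ ∧
      EmbeddedManifold.chordalBall ι x δ ⊆
        EmbeddedManifold.geodesicClosedBall d x (ENNReal.ofReal ε)) ∧
    (CompactSpace M → 0 < ⨅ x : M, EmbeddedManifold.injectivityRadius d ι x →
      0 < ⨅ x : M, EmbeddedManifold.chordalRadius ι x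
        (EmbeddedManifold.geodesicBall d x (EmbeddedManifold.injectivityRadius d ι x)) ∧
      0 < ⨅ x : M, EmbeddedManifold.chordalRadius ι x
        (EmbeddedManifold.geodesicClosedBall d x (EmbeddedManifold.injectivityRadius d ι x))) := by
  have : IsManifold (𝓡 d) 1 M := .of_le (n := ∞) (by simp)
  have : IsContinuousRiemannianBundle (EuclideanSpace ℝ (Fin d))
      (fun x : M => TangentSpace (𝓡 d) x) :=
    let ⟨g, hg, hgi⟩ := IsContMDiffRiemannianBundle.exists_contMDiff (IB := 𝓡 d) (n := ∞)
      (F := EuclideanSpace ℝ (Fin d)) (E := fun x : M => TangentSpace (𝓡 d) x)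
    ⟨g, hg.continuous, hgi⟩
  have hind : IsInducing ι := hι.isEmbedding.isInducing
  refine ⟨fun x ε hε => ?_, fun hM hR => ?_⟩
  · obtain ⟨δ, hδ, h⟩ := EmbeddedManifold.exists_chordalBall_subset_geodesicBall (d := d) hind x
      (ENNReal.ofReal_pos.2 hε)
    exact ⟨δ, hδ, h.trans (EmbeddedManifold.geodesicBall_subset_geodesicClosedBall x _)⟩
  · obtain ⟨δ, hδ, h⟩ := EmbeddedManifold.exists_forall_chordalBall_subset_geodesicBall (d := d)
      hind hR
    lift δ to ℝ≥0 using hδ.le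
    have hδ' : (0 : ℝ≥0∞) < δ := by exact_mod_cast hδ
    have hopen (x : M) : (δ : ℝ≥0∞) ≤ EmbeddedManifold.chordalRadius ι x
        (EmbeddedManifold.geodesicBall d x (EmbeddedManifold.injectivityRadius d ι x)) :=
      EmbeddedManifold.le_chordalRadius
        ((h x).trans (EmbeddedManifold.geodesicBall_mono x (iInf_le _ x)))
    exact ⟨hδ'.trans_le (le_iInf hopen), hδ'.trans_le (le_iInf fun x => (hopen x).trans
      (EmbeddedManifold.chordalRadius_mono ι x
        (EmbeddedManifold.geodesicBall_subset_geodesicClosedBall x _)))⟩
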